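/- Let $P(x)=x^4-x^3-x^2-x-1$. It has exactly one real root $\beta_2$ with $|\beta_2|<1$, and a pair of non-real complex conjugate roots; let $\beta_3$ be either one of these. For $i\in\mathbb Z$ put $\alpha^i=(\beta_2^i,\beta_3^i)\in\mathbb R\times\mathbb C$, with $\alpha=\alpha^1$, $1=\alpha^0$ and division by $\alpha$ taken coordinatewise. Let $\mathcal D^\infty$ be the set of sequences $(\varepsilon_i)_{i\ge l}$, $l\in\mathbb Z$, with $\varepsilon_i\in\{0,1\}$ for all $i\ge l$ and with no four consecutive terms all equal to $1$. Let $$S=\Big\{\pm\sum_{i=0}^3c_i\alpha^i:\ c_i\in\{0,1\},\ (c_0,c_1,c_2,c_3)\ne(1,1,1,1)\Big\}\cup\big\{\pm(\alpha^{-1}+1+\alpha^2),\ \pm(\alpha^{-2}+\alpha^{-1}+\alpha),\ \pm(\alpha^{-3}+\alpha^{-2}+1+\alpha^3)\big\},$$ and let $\mathcal A$ be the automaton with set of states $S$, initial state $0$, and edges all triples $(s,(a,b),t)\in S\times\{0,1\}^2\times S$ with $t=\frac{s}{\alpha}+(a-b)\alpha^3$. An infinite path of $\mathcal A$ starting in the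 initial state is a sequence $(a_n,b_n)_{n\ge k}$ for which there are $e_n\in S$ $(n\ge k)$ with $e_k=0$ such that $(e_n,(a_n,b_n),e_{n+1})$ is an edge for every $n\ge k$. Then for every $l\in\mathbb Z$ and all $(\varepsilon_i)_{i\ge l},(\varepsilon'_i)_{i\ge l}\in\mathcal D^\infty$ the series $\sum_{i\ge l}\varepsilon_i\alpha^i$ and $\sum_{i\ge l}\varepsilon'_i\alpha^i$ converge absolutely, and the following are equivalent: 1. $\sum_{i\ge l}\varepsilon_i\alpha^i=\sum_{i\ge l}\varepsilon'_i\alpha^i$; 2. $(\varepsilon_i,\varepsilon'_i)_{i\ge l}$ is an infinite path of $\mathcal A$ starting in the initial state $0$. -/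

import Mathlib

/-- The polynomial `x⁴ - x³ - x² - x - 1`. -/
noncomputable def tetraPoly : Polynomial ℤ :=
  Polynomial.X ^ 4 - Polynomial.X ^ 3 - Polynomial.X ^ 2 - Polynomial.X - 1

/-- The finite word `(ε_i)_{l ≤ i ≤ n}` belongs to `𝒟`: its digits are `0` or `1`, and no four
consecutive digits are all equal to `1`.  Only the values `ε i` with `l ≤ i ≤ n` matter. -/
def MemD (l n : ℤ) (ε : ℤ → ℕ) : Prop :=
  (∀ i, l ≤ i → i ≤ n → ε i = 0 ∨ ε i = 1) ∧
  ∀ i, l + 3 ≤ i → i ≤ n →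
    ¬ (ε i = 1 ∧ ε (i - 1) = 1 ∧ ε (i - 2) = 1 ∧ ε (i - 3) = 1)

/-- The one-sided infinite sequence `(ε_i)_{i ≥ l}` belongs to `𝒟^∞`: all its finite words
`(ε_i)_{l ≤ i ≤ n}` belong to `𝒟`.  Only the values `ε i` with `i ≥ l` matter. -/
def MemDInf (l : ℤ) (ε : ℤ → ℕ) : Prop :=
  ∀ n, l ≤ n → MemD l n ε

/-- `α^i = (β₂^i, β₃^i)` in `ℝ × ℂ`, for `i ∈ ℤ`. -/
noncomputable def alphaPow (β₂ : ℝ) (β₃ : ℂ) (i : ℤ) : ℝ × ℂ :=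
  (β₂ ^ i, β₃ ^ i)

/-- The state set `S`. -/
def stateSet (β₂ : ℝ) (β₃ : ℂ) : Set (ℝ × ℂ) :=
  {s | ∃ c : Fin 4 → ℕ, (∀ i, c i = 0 ∨ c i = 1) ∧ ¬ (∀ i, c i = 1) ∧
      (s = ∑ i : Fin 4, (c i : ℝ) • alphaPow β₂ β₃ (i : ℕ) ∨
       s = -∑ i : Fin 4, (c i : ℝ) • alphaPow β₂ β₃ (i : ℕ))} ∪
  {s | ∃ v : ℝ × ℂ, (s = v ∨ s = -v) ∧
      (v = alphaPow β₂ β₃ (-1) + alphaPow β₂ β₃ 0 + alphaPow β₂ β₃ 2 ∨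
       v = alphaPow β₂ β₃ (-2) + alphaPow β₂ β₃ (-1) + alphaPow β₂ β₃ 1 ∨
       v = alphaPow β₂ β₃ (-3) + alphaPow β₂ β₃ (-2) + alphaPow β₂ β₃ 0 + alphaPow β₂ β₃ 3)}

/-- A labelled automaton (all infinite paths count, so there are no final states). -/
structure PathAutomaton (Q Λ : Type*) where
  states : Set Q
  initial : Set Q
  edges : Set (Q × Λ × Q)

/-- The label sequence `(w_n)_{n ≥ k}` is an infinite path of `A` starting in an initial state:
there are states `(e_n)_{n ≥ k}` with `e_k` initial such that every `(e_n, w_n, e_{n+1})`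
is an edge. -/
def PathAutomaton.IsInfinitePathFromInitial {Q Λ : Type*} (A : PathAutomaton Q Λ)
    (k : ℤ) (w : ℤ → Λ) : Prop :=
  ∃ e : ℤ → Q, (∀ n, k ≤ n → e n ∈ A.states) ∧ e k ∈ A.initial ∧
    ∀ n, k ≤ n → (e n, w n, e (n + 1)) ∈ A.edges

/-- The automaton `𝒜`: states `S`, initial state `0`, and the edges `(s, (a, b), t)` in
`S × {0,1}² × S` with `t = s / α + (a - b) α³`, the division by `α` being coordinatewise. -/
noncomputable def tetraAutomaton (β₂ : ℝ) (β₃ : ℂ) : PathAutomaton (ℝ × ℂ) (ℕ × ℕ) where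
  states := stateSet β₂ β₃
  initial := {0}
  edges := {x | ∃ (s t : ℝ × ℂ) (a b : ℕ), x = (s, (a, b), t) ∧
    s ∈ stateSet β₂ β₃ ∧ t ∈ stateSet β₂ β₃ ∧ (a = 0 ∨ a = 1) ∧ (b = 0 ∨ b = 1) ∧
    t = (s.1 / β₂, s.2 / β₃) + ((a : ℝ) - (b : ℝ)) • alphaPow β₂ β₃ 3}

/-! Put `δ k = ε (l + k) - ε' (l + k)`. Edges of the automaton are deterministic, so the state after
`k` steps must be `α ^ (4 - k) * ∑ i < k, δ i * α ^ i` (`eval_mul_pow`), an element of `ℤ[α]` with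
integer coordinates. If the two series agree, this state is `-α ^ 4` times a tail, hence bounded at
each root `z` by `‖z‖ ^ 4 / (1 - ‖z‖)`. A finite search (`step_mem_states_or_escapes`) shows that a
path leaving the state set breaks one of these bounds within ten further steps, unless it leaves
through `±(1, 1, 1, 1)`; that exit needs four equal nonzero differences (`step_eq_ones`), so four
consecutive ones in `ε` or `ε'`. Conversely, states on an infinite path are bounded, so multiplying
by `z ^ k` gives a null sequence and the sum of the differences vanishes. -/

/-- The integer vector `(x₀, x₁, x₂, x₃)` stands for `x₀ + x₁ α + x₂ α² + x₃ α³`. -/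
abbrev QuadVec := ℤ × ℤ × ℤ × ℤ

/-! ### Integer coordinates and the finite search. -/

namespace QuadVec

/-- The coordinates of `x / α + d α³`. -/
def step (x : QuadVec) (d : ℤ) : QuadVec :=
  (x.2.1 - x.1, x.2.2.1 - x.1, x.2.2.2 - x.1, x.1 + d)

/-- The value of the vector at `α = z`. -/
def eval {K : Type*} [Ring K] (z : K) (x : QuadVec) : K :=
  x.1 + x.2.1 * z + x.2.2.1 * z ^ 2 + x.2.2.2 * z ^ 3

/-- The value at a root of largest modulus less than one is certified to be too large for the
value of a tail. -/
def exceeds (x : QuadVec) : Bool :=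
  -- Coefficients are `10000` times the powers of the root, rounded with error at most one; `e`
  -- absorbs the rounding. The thresholds are the tail bounds `1.602` and `2.47`.
  let e := x.2.1.natAbs + x.2.2.1.natAbs + x.2.2.2.natAbs
  decide (16020 + e < (10000 * x.1 - 7748 * x.2.1 + 6003 * x.2.2.1 - 4651 * x.2.2.2).natAbs) ||
  (decide (24700 + e < (10000 * x.1 - 764 * x.2.1 - 6579 * x.2.2.1 + 1516 * x.2.2.2).natAbs) ||
  decide (24700 + e < (8147 * x.2.1 - 1245 * x.2.2.1 - 5265 * x.2.2.2).natAbs))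

/-- Every path of length `k` starting at the vector runs into a vector that is too large. -/
def escapes : ℕ → QuadVec → Bool
  | 0, x => exceeds x
  | k + 1, x => exceeds x ||
      (escapes k (step x (-1)) && (escapes k (step x 0) && escapes k (step x 1)))

/-- The coordinates of the states of the automaton, up to sign and without `0`. -/
def halfStates : List QuadVec :=
  [(1, 0, 0, 0), (0, 1, 0, 0), (0, 0, 1, 0), (0, 0, 0, 1), (1, 1, 0, 0), (1, 0, 1, 0),
    (1, 0, 0, 1), (0, 1, 1, 0), (0, 1, 0, 1), (0, 0, 1, 1), (1, 1, 1, 0), (1, 1, 0, 1),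
    -- The last three vectors are the states given with negative powers, reduced modulo the quartic.
    (1, 0, 1, 1), (0, 1, 1, 1), (0, -1, 0, 1), (-1, 0, 1, 0), (1, 2, 1, 0)]

/-- The coordinates of the states of the automaton. -/
def states : List QuadVec :=
  (0, 0, 0, 0) :: (halfStates ++ halfStates.map fun x => -x)

theorem step_mem_states_or_escapes :
    ∀ x ∈ states, ∀ d ∈ [(-1 : ℤ), 0, 1], step x d ∈ states ∨ escapes 10 (step x d) = true ∨
      step x d = (1, 1, 1, 1) ∨ step x d = (-1, -1, -1, -1) := by
  decide +kernel

-- Backtracking from `(s, s, s, s)`: among states the predecessors are unique, and each step back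
-- reveals one more digit `s`.
set_option synthInstance.maxSize 1000 in
theorem step_eq_ones :
    ∀ x ∈ states, ∀ d ∈ [(-1 : ℤ), 0, 1], ∀ s ∈ [(-1 : ℤ), 1],
      (step x d = (s, s, s, s) → x = (0, s, s, s) ∧ d = s) ∧
      (step x d = (0, s, s, s) → x = (0, 0, s, s) ∧ d = s) ∧
      (step x d = (0, 0, s, s) → x = (0, 0, 0, s) ∧ d = s) ∧
      (step x d = (0, 0, 0, s) → d = s) := by
  decide +kernel

section Path

variable {v : ℕ → QuadVec} {δ : ℕ → ℤ}

theorem escapes_eq_false (hδ : ∀ k, δ k ∈ [(-1 : ℤ), 0, 1])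
    (hv : ∀ k, v (k + 1) = step (v k) (δ k)) (h : ∀ k, exceeds (v k) = false) (j k : ℕ) :
    escapes j (v k) = false := by
  induction j generalizing k with
  | zero => exact h k
  | succ j ih =>
    have h1 := ih (k + 1)
    rw [hv] at h1
    have h2 := hδ k
    simp only [List.mem_cons, List.not_mem_nil, or_false] at h2
    rcases h2 with h2 | h2 | h2 <;> rw [h2] at h1 <;> simp [escapes, h k, h1]

/-- A path from `0` with digits `-1, 0, 1`, not containing four consecutive digits `1` or four
consecutive digits `-1`, and whose vectors are never too large, stays within the states. -/
theorem mem_states_of_path (hδ : ∀ k, δ k ∈ [(-1 : ℤ), 0, 1]) (h0 : v 0 = 0)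
    (hv : ∀ k, v (k + 1) = step (v k) (δ k)) (h : ∀ k, exceeds (v k) = false)
    (h4 : ∀ s ∈ [(-1 : ℤ), 1], ∀ k,
      ¬ (δ (k + 3) = s ∧ δ (k + 2) = s ∧ δ (k + 1) = s ∧ δ k = s)) (k : ℕ) :
    v k ∈ states := by
  induction k using Nat.strong_induction_on with
  | _ k ih =>
    cases k with
    | zero => rw [h0]; decide
    | succ k =>
      have key : ∀ s ∈ [(-1 : ℤ), 1], v (k + 1) ≠ (s, s, s, s) := by
        intro s hs heq
        have hs0 : s ≠ 0 := by rintro rfl; revert hs; decide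
        -- A last coordinate `s ≠ 0` rules out time `0`, so a previous step exists.
        have hne : ∀ j a b c, v j = (a, b, c, s) → ∃ i, j = i + 1 := by
          intro j a b c hj
          cases j with
          | zero =>
            rw [h0] at hj
            simp only [Prod.ext_iff] at hj
            exact absurd hj.2.2.2.symm hs0
          | succ i => exact ⟨i, rfl⟩
        have prev := fun j (hj : j < k + 1) => step_eq_ones (v j) (ih j hj) (δ j) (hδ j) s hs
        obtain ⟨h1, d1⟩ := (prev k (by omega)).1 (by rw [← hv, heq])
        obtain ⟨k, rfl⟩ := hne _ _ _ _ h1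
        obtain ⟨h2, d2⟩ := (prev k (by omega)).2.1 (by rw [← hv, h1])
        obtain ⟨k, rfl⟩ := hne _ _ _ _ h2
        obtain ⟨h3, d3⟩ := (prev k (by omega)).2.2.1 (by rw [← hv, h2])
        obtain ⟨k, rfl⟩ := hne _ _ _ _ h3
        have d4 := (prev k (by omega)).2.2.2 (by rw [← hv, h3])
        exact h4 s hs k ⟨d1, d2, d3, d4⟩
      have h1 := step_mem_states_or_escapes (v k) (ih k (by omega)) (δ k) (hδ k)
      rw [← hv] at h1
      rcases h1 with h1 | h1 | h1 | h1
      · exact h1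
      · simp [escapes_eq_false hδ hv h] at h1
      · exact absurd h1 (key 1 (by decide))
      · exact absurd h1 (key (-1) (by decide))

end Path

/-! ### Values along a path and tails of the series. -/

theorem eval_step {K : Type*} [Field K] {z : K} (hz : z ^ 4 = z ^ 3 + z ^ 2 + z + 1)
    (x : QuadVec) (d : ℤ) : eval z (step x d) = eval z x / z + d * z ^ 3 := by
  have h0 : z ≠ 0 := by rintro rfl; simp at hz
  rw [div_add' _ _ _ h0, eq_div_iff h0]
  simp only [eval, step]
  push_cast
  linear_combination (x.1 : K) * hz

theorem eval_mul_pow {K : Type*} [Field K] {z : K} (hz : z ^ 4 = z ^ 3 + z ^ 2 + z + 1)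
    {v : ℕ → QuadVec} {δ : ℕ → ℤ} (h0 : v 0 = 0) (hv : ∀ k, v (k + 1) = step (v k) (δ k))
    (k : ℕ) : eval z (v k) * z ^ k = z ^ 4 * ∑ i ∈ Finset.range k, δ i * z ^ i := by
  have hz0 : z ≠ 0 := by rintro rfl; simp at hz
  induction k with
  | zero => simp [h0, eval]
  | succ k ih =>
    rw [hv, eval_step hz, Finset.sum_range_succ, mul_add, ← ih]
    field_simp
    ring

section Normed

variable {K : Type*} [NormedField K] {z : K} {v : ℕ → QuadVec} {δ : ℕ → ℤ}

/-- A vanishing total turns the partial sum into minus the tail, which a geometric series dominates.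
-/
theorem norm_eval_le_of_hasSum_zero [CompleteSpace K] (hz : z ^ 4 = z ^ 3 + z ^ 2 + z + 1)
    (hz1 : ‖z‖ < 1) (h0 : v 0 = 0) (hv : ∀ k, v (k + 1) = step (v k) (δ k))
    (hδ : ∀ k, ‖(δ k : K)‖ ≤ 1) (hs : HasSum (fun i => (δ i : K) * z ^ i) 0) (k : ℕ) :
    ‖eval z (v k)‖ ≤ ‖z‖ ^ 4 / (1 - ‖z‖) := by
  have hz0 : z ≠ 0 := by rintro rfl; simp at hz
  have hpos : 0 < ‖z‖ ^ k := pow_pos (norm_pos_iff.2 hz0) k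
  have hsplit := hs.summable.sum_add_tsum_nat_add k
  rw [hs.tsum_eq] at hsplit
  have hsum : ∑ i ∈ Finset.range k, (δ i : K) * z ^ i = -∑' i, (δ (i + k) : K) * z ^ (i + k) :=
    eq_neg_of_add_eq_zero_left hsplit
  have hgeom : HasSum (fun i : ℕ => ‖z‖ ^ k * ‖z‖ ^ i) (‖z‖ ^ k * (1 - ‖z‖)⁻¹) :=
    (hasSum_geometric_of_lt_one (norm_nonneg z) hz1).mul_left _
  have htail : ‖∑' i, (δ (i + k) : K) * z ^ (i + k)‖ ≤ ‖z‖ ^ k * (1 - ‖z‖)⁻¹ := by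
    refine tsum_of_norm_bounded hgeom fun i => ?_
    rw [norm_mul, norm_pow, pow_add, mul_comm (‖z‖ ^ k)]
    exact mul_le_of_le_one_left (by positivity) (hδ _)
  have h := congrArg norm (eval_mul_pow hz h0 hv k)
  rw [hsum, norm_mul, norm_mul, norm_neg, norm_pow, norm_pow] at h
  have h2 : ‖eval z (v k)‖ * ‖z‖ ^ k ≤ ‖z‖ ^ 4 / (1 - ‖z‖) * ‖z‖ ^ k := by
    rw [h, div_eq_mul_inv, mul_assoc, mul_comm (1 - ‖z‖)⁻¹]
    gcongr
  exact le_of_mul_le_mul_right h2 hpos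

theorem hasSum_zero_of_norm_eval_le (hz : z ^ 4 = z ^ 3 + z ^ 2 + z + 1)
    (hz1 : ‖z‖ < 1) (h0 : v 0 = 0) (hv : ∀ k, v (k + 1) = step (v k) (δ k))
    (hs : Summable (fun i => (δ i : K) * z ^ i)) {C : ℝ} (hC : ∀ k, ‖eval z (v k)‖ ≤ C) :
    ∑' i, (δ i : K) * z ^ i = 0 := by
  have hz0 : z ≠ 0 := by rintro rfl; simp at hz
  have h1 := hs.hasSum.tendsto_sum_nat.const_mul (z ^ 4)
  have h2 : Filter.Tendsto (fun k => eval z (v k) * z ^ k) Filter.atTop (nhds 0) := by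
    refine squeeze_zero_norm (a := fun k => C * ‖z‖ ^ k) (fun k => ?_) ?_
    · rw [norm_mul, norm_pow]
      gcongr
      exact hC k
    · simpa using (tendsto_pow_atTop_nhds_zero_of_lt_one (norm_nonneg z) hz1).const_mul C
  simp only [eval_mul_pow hz h0 hv] at h2
  simpa [hz0] using tendsto_nhds_unique h1 h2

end Normed

end QuadVec

/-! ### Numerical location of the roots. -/

theorem aeval_tetraPoly_eq_zero_iff {K : Type*} [CommRing K] {z : K} :
    Polynomial.aeval z tetraPoly = 0 ↔ z ^ 4 = z ^ 3 + z ^ 2 + z + 1 := by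
  simp only [tetraPoly, map_sub, map_pow, Polynomial.aeval_X, map_one]
  constructor <;> intro h <;> linear_combination h

theorem smallRealRoot_bounds {b : ℝ} (hb : b ^ 4 = b ^ 3 + b ^ 2 + b + 1) (h1 : |b| < 1) :
    -0.774805 < b ∧ b < -0.774804 := by
  obtain ⟨h2, h3⟩ := abs_lt.1 h1
  have hneg : b < 0 := by
    by_contra! h
    nlinarith [pow_le_one₀ h h3.le (n := 4), pow_nonneg h 2, pow_nonneg h 3]
  constructor
  · by_contra! h
    -- The cubic is the rounded quotient of the quartic by the linear factor; it is negative on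
    -- `(-1, 0)`.
    have : (b + 0.774805) * (b ^ 3 - 1.774805 * b ^ 2 + 0.375127 * b - 1.290650) ≥ 0 :=
      mul_nonneg_of_nonpos_of_nonpos (by linarith) (by nlinarith [pow_two_nonneg b])
    nlinarith
  · by_contra! h
    have : (b + 0.774804) * (b ^ 3 - 1.774804 * b ^ 2 + 0.375125 * b - 1.290648) ≤ 0 :=
      mul_nonpos_of_nonneg_of_nonpos (by linarith) (by nlinarith [pow_two_nonneg b])
    nlinarith

theorem exists_largeRealRoot :
    ∃ a : ℝ, a ^ 4 = a ^ 3 + a ^ 2 + a + 1 ∧ 1.927561 < a ∧ a < 1.927562 := by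
  have hc : ContinuousOn (fun a : ℝ => a ^ 4 - a ^ 3 - a ^ 2 - a - 1)
      (Set.Icc 1.927561 1.927562) := by fun_prop
  obtain ⟨a, ha, h⟩ := intermediate_value_Ioo (by norm_num) hc
    (show (0 : ℝ) ∈ Set.Ioo _ _ by constructor <;> norm_num)
  exact ⟨a, by linear_combination h, ha.1, ha.2⟩

/-- The real part of a non-real root, and the squared modulus. -/
theorem nonrealRoot_re_normSq {b : ℝ} (hb : b ^ 4 = b ^ 3 + b ^ 2 + b + 1) (h1 : |b| < 1)
    {z : ℂ} (hz : z ^ 4 = z ^ 3 + z ^ 2 + z + 1) (him : z.im ≠ 0) :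
    (-0.07638 < z.re ∧ z.re < -0.076378) ∧ (0.66956 < z.re ^ 2 + z.im ^ 2 ∧
      z.re ^ 2 + z.im ^ 2 < 0.669585) := by
  obtain ⟨a, ha, ha1, ha2⟩ := exists_largeRealRoot
  obtain ⟨hb1, hb2⟩ := smallRealRoot_bounds hb h1
  have hab : a - b ≠ 0 := by linarith
  set s := 1 - a - b with hs
  set p := b ^ 2 + a * b + a ^ 2 - a - b - 1 with hp
  -- The divided difference of the quartic at its roots `a` and `b`; removing both linear factors
  -- leaves the quadratic with root sum `s` and product `p`.
  have hquot : (b ^ 3 + (a - 1) * b ^ 2 + (a ^ 2 - a - 1) * b + (a ^ 3 - a ^ 2 - a - 1)) = 0 := by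
    apply mul_left_cancel₀ hab
    linear_combination ha - hb
  have hfac : (z - a) * ((z - b) * (z ^ 2 - s * z + p)) = 0 := by
    have ha' : (a : ℂ) ^ 4 = a ^ 3 + a ^ 2 + a + 1 := by exact_mod_cast ha
    have hquot' : ((b : ℂ) ^ 3 + (a - 1) * b ^ 2 + (a ^ 2 - a - 1) * b +
      (a ^ 3 - a ^ 2 - a - 1)) = 0 := by exact_mod_cast hquot
    rw [hs, hp]
    push_cast
    linear_combination hz - ha' - (z - a) * hquot'
  have hne : ∀ r : ℝ, z - r ≠ 0 := by
    intro r h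
    apply him
    simpa using congrArg Complex.im h
  have hq := (mul_eq_zero.1 ((mul_eq_zero.1 hfac).resolve_left (hne a))).resolve_left (hne b)
  have hre := congrArg Complex.re hq
  have him' := congrArg Complex.im hq
  simp [pow_two] at hre him'
  have hu : z.re = s / 2 := by
    apply mul_left_cancel₀ him
    linarith
  have hN : z.re ^ 2 + z.im ^ 2 = p := by
    have : s = 2 * z.re := by linarith
    rw [this] at hre
    linarith
  rw [hN, hu]
  refine ⟨⟨by linarith, by linarith⟩, ?_, ?_⟩ <;> rw [hp] <;>
    nlinarith [mul_nonneg (sub_nonneg.2 ha1.le) (sub_nonneg.2 hb1.le),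
      mul_nonneg (sub_nonneg.2 ha2.le) (sub_nonneg.2 hb1.le),
      mul_nonneg (sub_nonneg.2 ha1.le) (sub_nonneg.2 hb2.le),
      mul_nonneg (sub_nonneg.2 ha2.le) (sub_nonneg.2 hb2.le),
      mul_nonneg (sub_nonneg.2 ha1.le) (sub_nonneg.2 ha2.le),
      mul_nonneg (sub_nonneg.2 hb1.le) (sub_nonneg.2 hb2.le), sq_nonneg (a - 1.9275615),
      sq_nonneg (b + 0.7748045)]

theorem nonrealRoot_norm_bounds {b : ℝ} (hb : b ^ 4 = b ^ 3 + b ^ 2 + b + 1) (h1 : |b| < 1)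
    {z : ℂ} (hz : z ^ 4 = z ^ 3 + z ^ 2 + z + 1) (him : z.im ≠ 0) : ‖z‖ < 0.8183 := by
  obtain ⟨-, -, h⟩ := nonrealRoot_re_normSq hb h1 hz him
  refine lt_of_pow_lt_pow_left₀ 2 (by norm_num) ?_
  rw [Complex.sq_norm, Complex.normSq_apply]
  nlinarith

theorem nonrealRoot_im_bounds {b : ℝ} (hb : b ^ 4 = b ^ 3 + b ^ 2 + b + 1) (h1 : |b| < 1)
    {z : ℂ} (hz : z ^ 4 = z ^ 3 + z ^ 2 + z + 1) (him : 0 < z.im) :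
    0.81468 < z.im ∧ z.im < 0.81472 := by
  obtain ⟨⟨h2, h3⟩, h4, h5⟩ := nonrealRoot_re_normSq hb h1 hz him.ne'
  constructor <;> nlinarith

/-! ### Soundness of the size test. -/

namespace QuadVec

/-- An approximation of a linear functional with error at most one per coordinate. -/
theorem natAbs_le_of_abs_eval_le {x : QuadVec} {c₁ c₂ c₃ : ℝ} {K A₁ A₂ A₃ : ℤ} {C : ℝ} {M : ℕ}
    {c₀ : ℝ} (h0 : 10000 * c₀ = K) (h1 : |10000 * c₁ - A₁| ≤ 1) (h2 : |10000 * c₂ - A₂| ≤ 1)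
    (h3 : |10000 * c₃ - A₃| ≤ 1) (hM : 10000 * C ≤ M)
    (h : |x.1 * c₀ + x.2.1 * c₁ + x.2.2.1 * c₂ + x.2.2.2 * c₃| ≤ C) :
    (K * x.1 + A₁ * x.2.1 + A₂ * x.2.2.1 + A₃ * x.2.2.2).natAbs ≤
      M + (x.2.1.natAbs + x.2.2.1.natAbs + x.2.2.2.natAbs) := by
  rw [← Nat.cast_le (α := ℝ)]
  push_cast [Nat.cast_natAbs]
  have e : ∀ (n : ℤ) (c : ℝ) (A : ℤ), |10000 * c - A| ≤ 1 →
      |(n : ℝ) * (10000 * c - A)| ≤ |(n : ℝ)| := fun n c A hc => by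
    rw [abs_mul]
    exact mul_le_of_le_one_right (abs_nonneg _) hc
  have e1 := abs_le.1 (e x.2.1 c₁ A₁ h1)
  have e2 := abs_le.1 (e x.2.2.1 c₂ A₂ h2)
  have e3 := abs_le.1 (e x.2.2.2 c₃ A₃ h3)
  have e0 := abs_le.1 h
  have : (K * x.1 : ℝ) = 10000 * (x.1 * c₀) := by rw [← h0]; ring
  rw [abs_le]
  constructor <;> linarith [e1.1, e1.2, e2.1, e2.2, e3.1, e3.2, e0.1, e0.2]

theorem approx_real {b : ℝ} (hb1 : -0.774805 < b) (hb2 : b < -0.774804) :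
    |10000 * b - (-7748 : ℤ)| ≤ 1 ∧ |10000 * b ^ 2 - (6003 : ℤ)| ≤ 1 ∧
      |10000 * b ^ 3 - (-4651 : ℤ)| ≤ 1 := by
  have hbb1 : 0.600321 < b ^ 2 := by nlinarith
  have hbb2 : b ^ 2 < 0.600323 := by nlinarith
  simp only [abs_le]
  push_cast
  refine ⟨⟨?_, ?_⟩, ⟨?_, ?_⟩, ?_, ?_⟩
  · linarith
  · linarith
  · linarith
  · linarith
  · nlinarith
  · nlinarith

theorem approx_complex {u w : ℝ} (hu1 : -0.07638 < u) (hu2 : u < -0.076378)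
    (hw1 : 0.81468 < w) (hw2 : w < 0.81472) :
    |10000 * u - (-764 : ℤ)| ≤ 1 ∧ |10000 * (u ^ 2 - w ^ 2) - (-6579 : ℤ)| ≤ 1 ∧
      |10000 * (u * (u ^ 2 - 3 * w ^ 2)) - (1516 : ℤ)| ≤ 1 ∧
      |10000 * w - (8147 : ℤ)| ≤ 1 ∧ |10000 * (2 * (u * w)) - (-1245 : ℤ)| ≤ 1 ∧
      |10000 * (w * (3 * u ^ 2 - w ^ 2)) - (-5265 : ℤ)| ≤ 1 := by
  have hu : 0.005833 < u ^ 2 ∧ u ^ 2 < 0.005835 := by constructor <;> nlinarith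
  have hw : 0.6637 < w ^ 2 ∧ w ^ 2 < 0.66377 := by constructor <;> nlinarith
  have hq : -1.985477 < u ^ 2 - 3 * w ^ 2 ∧ u ^ 2 - 3 * w ^ 2 < -1.985265 := by
    constructor <;> linarith [hu.1, hu.2, hw.1, hw.2]
  have hr : -0.646271 < 3 * u ^ 2 - w ^ 2 ∧ 3 * u ^ 2 - w ^ 2 < -0.646195 := by
    constructor <;> linarith [hu.1, hu.2, hw.1, hw.2]
  obtain ⟨hq1, hq2⟩ := hq
  obtain ⟨hr1, hr2⟩ := hr
  -- Naming the quadratic factors reduces the cubic estimates to products of two bounded quantities.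
  generalize hQ : u ^ 2 - 3 * w ^ 2 = q at *
  generalize hR : 3 * u ^ 2 - w ^ 2 = r at *
  simp only [abs_le]
  push_cast
  refine ⟨⟨?_, ?_⟩, ⟨?_, ?_⟩, ⟨?_, ?_⟩, ⟨?_, ?_⟩, ⟨?_, ?_⟩, ?_, ?_⟩
  · linarith
  · linarith
  · linarith [hu.1, hu.2, hw.1, hw.2]
  · linarith [hu.1, hu.2, hw.1, hw.2]
  · clear hu hw hQ hR; nlinarith
  · clear hu hw hQ hR; nlinarith
  · linarith
  · linarith
  · clear hu hw hQ hR; nlinarith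
  · clear hu hw hQ hR; nlinarith
  · clear hu hw hQ hR; nlinarith
  · clear hu hw hQ hR; nlinarith

theorem exceeds_eq_false {b : ℝ} (hb : b ^ 4 = b ^ 3 + b ^ 2 + b + 1) (h1 : |b| < 1)
    {z : ℂ} (hz : z ^ 4 = z ^ 3 + z ^ 2 + z + 1) (him : 0 < z.im) {x : QuadVec}
    (hxb : |eval b x| ≤ 1.602) (hxz : ‖eval z x‖ ≤ 2.47) : exceeds x = false := by
  obtain ⟨hb1, hb2⟩ := smallRealRoot_bounds hb h1
  obtain ⟨⟨hu1, hu2⟩, -⟩ := nonrealRoot_re_normSq hb h1 hz him.ne'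
  obtain ⟨hv1, hv2⟩ := nonrealRoot_im_bounds hb h1 hz him
  have hre : |x.1 * 1 + x.2.1 * z.re + x.2.2.1 * (z.re ^ 2 - z.im ^ 2) +
      x.2.2.2 * (z.re * (z.re ^ 2 - 3 * z.im ^ 2))| ≤ 2.47 := by
    refine le_trans (le_of_eq ?_) ((Complex.abs_re_le_norm _).trans hxz)
    simp only [eval, pow_succ, pow_zero, one_mul, Complex.add_re, Complex.mul_re, Complex.mul_im,
      Complex.intCast_re, Complex.intCast_im]
    ring_nf
  have him : |x.1 * 0 + x.2.1 * z.im + x.2.2.1 * (2 * (z.re * z.im)) +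
      x.2.2.2 * (z.im * (3 * z.re ^ 2 - z.im ^ 2))| ≤ 2.47 := by
    refine le_trans (le_of_eq ?_) ((Complex.abs_im_le_norm _).trans hxz)
    simp only [eval, pow_succ, pow_zero, one_mul, Complex.add_im, Complex.mul_re, Complex.mul_im,
      Complex.intCast_re, Complex.intCast_im]
    ring_nf
  have hb' : |x.1 * 1 + x.2.1 * b + x.2.2.1 * b ^ 2 + x.2.2.2 * b ^ 3| ≤ 1.602 := by
    simpa [eval] using hxb
  obtain ⟨b1, b2, b3⟩ := approx_real hb1 hb2
  obtain ⟨u1, u2, u3, w1, w2, w3⟩ := approx_complex hu1 hu2 hv1 hv2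
  have i1 := natAbs_le_of_abs_eval_le (K := 10000) (M := 16020) (by norm_num) b1 b2 b3
    (by norm_num) hb'
  have i2 := natAbs_le_of_abs_eval_le (K := 10000) (M := 24700) (by norm_num) u1 u2 u3
    (by norm_num) hre
  have i3 := natAbs_le_of_abs_eval_le (K := 0) (M := 24700) (by norm_num) w1 w2 w3
    (by norm_num) him
  simp only [exceeds, Bool.or_eq_false_iff, decide_eq_false_iff_not, not_lt]
  refine ⟨le_trans (le_of_eq ?_) i1, le_trans (le_of_eq ?_) i2, le_trans (le_of_eq ?_) i3⟩ <;>
    congr 1 <;> ring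

end QuadVec

/-! ### From integer vectors to states in `ℝ × ℂ`. -/

namespace QuadVec

/-- The point `(x(β₂), x(β₃))` of `ℝ × ℂ`. -/
noncomputable def embed (β₂ : ℝ) (β₃ : ℂ) (x : QuadVec) : ℝ × ℂ :=
  (eval β₂ x, eval β₃ x)

theorem embed_neg (β₂ : ℝ) (β₃ : ℂ) (x : QuadVec) : embed β₂ β₃ (-x) = -embed β₂ β₃ x := by
  ext1 <;> simp [embed, eval] <;> ring

theorem embed_mem_stateSet_of_digits {β₂ : ℝ} {β₃ : ℂ} (c : Fin 4 → ℕ)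
    (hc : ∀ i, c i = 0 ∨ c i = 1) (hc' : ¬ ∀ i, c i = 1) :
    embed β₂ β₃ (c 0, c 1, c 2, c 3) ∈ stateSet β₂ β₃ := by
  refine Or.inl ⟨c, hc, hc', Or.inl ?_⟩
  ext1 <;> simp [embed, eval, alphaPow, Fin.sum_univ_four]

theorem zpow_neg_root {K : Type*} [Field K] {z : K} (hz : z ^ 4 = z ^ 3 + z ^ 2 + z + 1) :
    z ^ (-1 : ℤ) = z ^ 3 - z ^ 2 - z - 1 ∧ z ^ (-2 : ℤ) = 2 * z ^ 2 - z ^ 3 ∧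
      z ^ (-3 : ℤ) = 2 * z - z ^ 2 := by
  refine ⟨?_, ?_, ?_⟩ <;> rw [zpow_neg, zpow_ofNat] <;> apply inv_eq_of_mul_eq_one_right
  · linear_combination hz
  · linear_combination (1 - z) * hz
  · linear_combination (1 - z) * hz

theorem neg_mem_stateSet {β₂ : ℝ} {β₃ : ℂ} {s : ℝ × ℂ} (hs : s ∈ stateSet β₂ β₃) :
    -s ∈ stateSet β₂ β₃ := by
  rcases hs with ⟨c, hc, hc', h⟩ | ⟨v, h, hv⟩
  · refine Or.inl ⟨c, hc, hc', ?_⟩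
    rcases h with rfl | rfl
    · exact Or.inr rfl
    · exact Or.inl (neg_neg _)
  · refine Or.inr ⟨v, ?_, hv⟩
    rcases h with rfl | rfl
    · exact Or.inr rfl
    · exact Or.inl (neg_neg _)

theorem embed_mem_stateSet {β₂ : ℝ} {β₃ : ℂ} (h₂ : β₂ ^ 4 = β₂ ^ 3 + β₂ ^ 2 + β₂ + 1)
    (h₃ : β₃ ^ 4 = β₃ ^ 3 + β₃ ^ 2 + β₃ + 1) {x : QuadVec} (hx : x ∈ states) :
    embed β₂ β₃ x ∈ stateSet β₂ β₃ := by
  have key : ∀ x ∈ halfStates, embed β₂ β₃ x ∈ stateSet β₂ β₃ := by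
    intro x hx
    have hclass : (∃ c : Fin 4 → Fin 2, (¬ ∀ i, c i = 1) ∧
        x = (((c 0 : ℕ) : ℤ), ((c 1 : ℕ) : ℤ), ((c 2 : ℕ) : ℤ), ((c 3 : ℕ) : ℤ))) ∨
        x = (0, -1, 0, 1) ∨ x = (-1, 0, 1, 0) ∨ x = (1, 2, 1, 0) := by
      revert x hx; decide +kernel
    obtain ⟨i₂, j₂, k₂⟩ := zpow_neg_root h₂
    obtain ⟨i₃, j₃, k₃⟩ := zpow_neg_root h₃
    rcases hclass with ⟨c, hc, rfl⟩ | h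
    · refine embed_mem_stateSet_of_digits (fun i => (c i : ℕ)) (fun i => ?_) fun h => hc fun i => ?_
      · have := (c i).isLt
        omega
      · exact Fin.ext (h i)
    · refine Or.inr ⟨_, Or.inl rfl, ?_⟩
      refine h.imp ?_ (Or.imp ?_ ?_) <;> rintro rfl <;> ext1 <;>
        simp only [embed, eval, alphaPow, Prod.fst_add, Prod.snd_add, zpow_ofNat, i₂, j₂, k₂, i₃,
          j₃, k₃] <;> push_cast <;> ring
  rcases List.mem_cons.1 hx with rfl | hx
  · exact embed_mem_stateSet_of_digits (fun _ => 0) (by simp) (by simp)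
  rcases List.mem_append.1 hx with hx | hx
  · exact key x hx
  · obtain ⟨y, hy, rfl⟩ := List.mem_map.1 hx
    rw [embed_neg]
    exact neg_mem_stateSet (key y hy)

theorem embed_step {β₂ : ℝ} {β₃ : ℂ} (h₂ : β₂ ^ 4 = β₂ ^ 3 + β₂ ^ 2 + β₂ + 1)
    (h₃ : β₃ ^ 4 = β₃ ^ 3 + β₃ ^ 2 + β₃ + 1) (x : QuadVec) (a b : ℕ) :
    embed β₂ β₃ (step x (a - b)) = ((embed β₂ β₃ x).1 / β₂, (embed β₂ β₃ x).2 / β₃) +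
      ((a : ℝ) - (b : ℝ)) • alphaPow β₂ β₃ 3 := by
  ext1
  · simp [embed, eval_step h₂, alphaPow]
  · simp [embed, eval_step h₃, alphaPow]

/-- The vectors along the path with digits `δ`. -/
def path (δ : ℕ → ℤ) : ℕ → QuadVec
  | 0 => 0
  | k + 1 => step (path δ k) (δ k)

end QuadVec

/-- Serves only to bound the states in norm for the converse direction. -/
theorem stateSet_finite (β₂ : ℝ) (β₃ : ℂ) : (stateSet β₂ β₃).Finite := by
  refine Set.Finite.union ?_ ?_
  · have hC : ({c | ∀ i, c i = 0 ∨ c i = 1} : Set (Fin 4 → ℕ)).Finite := by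
      have := Set.Finite.pi' (ι := Fin 4) (t := fun _ => ({0, 1} : Set ℕ)) fun _ => Set.toFinite _
      simpa using this
    refine ((hC.image fun c => ∑ i : Fin 4, (c i : ℝ) • alphaPow β₂ β₃ (i : ℕ)).union
      (hC.image fun c => -∑ i : Fin 4, (c i : ℝ) • alphaPow β₂ β₃ (i : ℕ))).subset ?_
    rintro s ⟨c, hc, -, rfl | rfl⟩
    · exact Or.inl ⟨c, hc, rfl⟩
    · exact Or.inr ⟨c, hc, rfl⟩
  · have hf : ∀ a b c : ℝ × ℂ,
        {s | ∃ v, (s = v ∨ s = -v) ∧ (v = a ∨ v = b ∨ v = c)}.Finite := fun a b c => by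
      have h := Set.toFinite {a, b, c}
      refine (h.union (h.image fun v => -v)).subset ?_
      rintro s ⟨v, rfl | rfl, hv⟩
      · exact Or.inl hv
      · exact Or.inr ⟨v, hv, rfl⟩
    exact hf _ _ _

/-! ### Digit sequences and their series. -/

theorem MemDInf.eq_zero_or_one {l : ℤ} {ε : ℤ → ℕ} (h : MemDInf l ε) (k : ℕ) :
    ε (l + k) = 0 ∨ ε (l + k) = 1 :=
  (h (l + k) (by omega)).1 _ (by omega) le_rfl

theorem MemDInf.not_four_ones {l : ℤ} {ε : ℤ → ℕ} (h : MemDInf l ε) (k : ℕ) :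
    ¬ (ε (l + (k + 3 : ℕ)) = 1 ∧ ε (l + (k + 2 : ℕ)) = 1 ∧ ε (l + (k + 1 : ℕ)) = 1 ∧
      ε (l + k) = 1) := by
  have := (h (l + (k + 3 : ℕ)) (by omega)).2 _ (by push_cast; omega) le_rfl
  have e1 : l + ((k + 3 : ℕ) : ℤ) - 1 = l + (k + 2 : ℕ) := by push_cast; ring
  have e2 : l + ((k + 3 : ℕ) : ℤ) - 2 = l + (k + 1 : ℕ) := by push_cast; ring
  have e3 : l + ((k + 3 : ℕ) : ℤ) - 3 = l + k := by push_cast; ring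
  rwa [e1, e2, e3] at this

/-- Shifting the index set `{i | l ≤ i}` to the natural numbers. -/
def natEquivIci (l : ℤ) : ℕ ≃ Set.Ici l where
  toFun k := ⟨l + k, by simp⟩
  invFun i := (i.1 - l).toNat
  left_inv k := by simp
  right_inv i := by
    have := Set.mem_Ici.1 i.2
    ext
    simp [this]

theorem summable_digits {K : Type*} [NormedField K] [CompleteSpace K] {z : K} (hz1 : ‖z‖ < 1)
    {d : ℕ → K} (hd : ∀ k, ‖d k‖ ≤ 1) : Summable fun k => d k * z ^ k := by
  refine Summable.of_norm_bounded (summable_geometric_of_lt_one (norm_nonneg z) hz1) fun k => ?_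
  rw [norm_mul, norm_pow]
  exact mul_le_of_le_one_left (by positivity) (hd k)

section Series

variable {β₂ : ℝ} {β₃ : ℂ}

theorem smul_alphaPow_add (h₂ : β₂ ≠ 0) (h₃ : β₃ ≠ 0) (l : ℤ) (e k : ℕ) :
    (e : ℝ) • alphaPow β₂ β₃ (l + k) = alphaPow β₂ β₃ l * ((e : ℝ) * β₂ ^ k, (e : ℂ) * β₃ ^ k) := by
  ext1 <;> simp [alphaPow, zpow_add₀ h₂, zpow_add₀ h₃] <;> ring

theorem hasSum_digits_alphaPow (h₂ : β₂ ≠ 0) (h₃ : β₃ ≠ 0) (h₂' : ‖β₂‖ < 1) (h₃' : ‖β₃‖ < 1)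
    {l : ℤ} {ε : ℤ → ℕ} (hε : MemDInf l ε) :
    HasSum (fun i : Set.Ici l => (ε i : ℝ) • alphaPow β₂ β₃ i)
      (alphaPow β₂ β₃ l * (∑' k : ℕ, (ε (l + k) : ℝ) * β₂ ^ k,
        ∑' k : ℕ, (ε (l + k) : ℂ) * β₃ ^ k)) := by
  rw [← (natEquivIci l).hasSum_iff]
  have e : ((fun i : Set.Ici l => (ε i : ℝ) • alphaPow β₂ β₃ i) ∘ natEquivIci l) =
      fun k : ℕ => alphaPow β₂ β₃ l * ((ε (l + k) : ℝ) * β₂ ^ k, (ε (l + k) : ℂ) * β₃ ^ k) := by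
    ext1 k
    exact smul_alphaPow_add h₂ h₃ l _ k
  rw [e]
  refine HasSum.mul_left _ (HasSum.prodMk ?_ ?_)
  · refine (summable_digits h₂' fun k => ?_).hasSum
    rcases hε.eq_zero_or_one k with h | h <;> simp [h]
  · refine (summable_digits h₃' fun k => ?_).hasSum
    rcases hε.eq_zero_or_one k with h | h <;> simp [h]

/-- Equality of the two series in terms of the differences of the digits. -/
theorem tsum_eq_iff (h₂ : β₂ ≠ 0) (h₃ : β₃ ≠ 0) (h₂' : ‖β₂‖ < 1) (h₃' : ‖β₃‖ < 1)
    {l : ℤ} {ε ε' : ℤ → ℕ} (hε : MemDInf l ε) (hε' : MemDInf l ε') :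
    (∑' i : Set.Ici l, (ε i : ℝ) • alphaPow β₂ β₃ i =
        ∑' i : Set.Ici l, (ε' i : ℝ) • alphaPow β₂ β₃ i) ↔
      ∑' k : ℕ, (((ε (l + k) : ℤ) - ε' (l + k) : ℤ) : ℝ) * β₂ ^ k = 0 ∧
      ∑' k : ℕ, (((ε (l + k) : ℤ) - ε' (l + k) : ℤ) : ℂ) * β₃ ^ k = 0 := by
  rw [(hasSum_digits_alphaPow h₂ h₃ h₂' h₃' hε).tsum_eq,
    (hasSum_digits_alphaPow h₂ h₃ h₂' h₃' hε').tsum_eq]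
  have b : ∀ {η : ℤ → ℕ}, MemDInf l η → ∀ {K : Type} [RCLike K] (k : ℕ),
      ‖(η (l + k) : K)‖ ≤ 1 := fun hη K _ k => by
    rcases hη.eq_zero_or_one k with h | h <;> simp [h]
  have s₂ := (summable_digits h₂' (b hε)).tsum_sub (summable_digits h₂' (b hε'))
  have s₃ := (summable_digits h₃' (b hε)).tsum_sub (summable_digits h₃' (b hε'))
  simp only [← sub_mul] at s₂ s₃
  push_cast
  rw [s₂, s₃, sub_eq_zero, sub_eq_zero, Prod.ext_iff]
  simp [alphaPow, zpow_ne_zero, h₂, h₃]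

end Series

/-! ### Both directions of the equivalence. -/

namespace QuadVec

theorem eval_conj (z : ℂ) (x : QuadVec) :
    eval (starRingEnd ℂ z) x = starRingEnd ℂ (eval z x) := by
  simp [eval]

/-- Integer coordinates make evaluation commute with conjugation, so the root may be taken in the
upper half-plane. -/
theorem exceeds_eq_false_of_im_ne_zero {b : ℝ} (hb : b ^ 4 = b ^ 3 + b ^ 2 + b + 1)
    (h1 : |b| < 1) {z : ℂ} (hz : z ^ 4 = z ^ 3 + z ^ 2 + z + 1) (him : z.im ≠ 0) {x : QuadVec}
    (hxb : |eval b x| ≤ 1.602) (hxz : ‖eval z x‖ ≤ 2.47) : exceeds x = false := by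
  rcases him.lt_or_gt with h | h
  · refine exceeds_eq_false hb h1 (z := starRingEnd ℂ z) ?_ (by simpa using h) hxb ?_
    · simpa using congrArg (starRingEnd ℂ) hz
    · rwa [eval_conj, RCLike.norm_conj]
  · exact exceeds_eq_false hb h1 hz h hxb hxz

theorem tail_bound {r r' C : ℝ} (h0 : 0 ≤ r) (h : r ≤ r') (h1 : r' < 1)
    (hC : r' ^ 4 / (1 - r') ≤ C) : r ^ 4 / (1 - r) ≤ C := by
  refine le_trans ?_ hC
  have : 0 < 1 - r' := by linarith
  gcongr

section Main

variable {β₂ : ℝ} {β₃ : ℂ} {l : ℤ} {ε ε' : ℤ → ℕ}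

/-- If the two series agree, then the vectors along the path of digit differences are states. -/
theorem path_mem_states (h₂ : β₂ ^ 4 = β₂ ^ 3 + β₂ ^ 2 + β₂ + 1) (h₂' : |β₂| < 1)
    (h₃ : β₃ ^ 4 = β₃ ^ 3 + β₃ ^ 2 + β₃ + 1) (h₃' : β₃.im ≠ 0)
    (hε : MemDInf l ε) (hε' : MemDInf l ε')
    (s₂ : ∑' k : ℕ, (((ε (l + k) : ℤ) - ε' (l + k) : ℤ) : ℝ) * β₂ ^ k = 0)
    (s₃ : ∑' k : ℕ, (((ε (l + k) : ℤ) - ε' (l + k) : ℤ) : ℂ) * β₃ ^ k = 0) (k : ℕ) :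
    path (fun k => (ε (l + k) : ℤ) - ε' (l + k)) k ∈ states := by
  have hd : ∀ k : ℕ, (ε (l + k) : ℤ) - ε' (l + k) ∈ [(-1 : ℤ), 0, 1] := fun k => by
    rcases hε.eq_zero_or_one k with h | h <;> rcases hε'.eq_zero_or_one k with h' | h' <;>
      simp [h, h']
  have hn : ∀ {K : Type} [RCLike K] (k : ℕ),
      ‖(((ε (l + k) : ℤ) - ε' (l + k) : ℤ) : K)‖ ≤ 1 := fun k => by
    rcases hε.eq_zero_or_one k with h | h <;> rcases hε'.eq_zero_or_one k with h' | h' <;>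
      simp [h, h']
  have n₃ := nonrealRoot_norm_bounds h₂ h₂' h₃ h₃'
  have n₃' : ‖β₃‖ < 1 := n₃.trans (by norm_num)
  obtain ⟨n₂, n₂'⟩ := smallRealRoot_bounds h₂ h₂'
  refine mem_states_of_path hd rfl (fun _ => rfl) (fun k => ?_) ?_ k
  · refine exceeds_eq_false_of_im_ne_zero h₂ h₂' h₃ h₃' ?_ ?_
    · have hs := (summable_digits (z := β₂) h₂' hn).hasSum
      rw [s₂] at hs
      refine (norm_eval_le_of_hasSum_zero h₂ h₂' rfl (fun _ => rfl) hn hs k).trans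
        (tail_bound (norm_nonneg _) (r' := 0.774805) ?_ (by norm_num) (by norm_num))
      rw [Real.norm_eq_abs, abs_le]
      constructor <;> linarith
    · have hs := (summable_digits (z := β₃) n₃' hn).hasSum
      rw [s₃] at hs
      exact (norm_eval_le_of_hasSum_zero h₃ n₃' rfl (fun _ => rfl) hn hs k).trans
        (tail_bound (norm_nonneg _) n₃.le (by norm_num) (by norm_num))
  · intro s hs k ⟨d3, d2, d1, d0⟩
    -- For digits in `{0, 1}`, difference `1` forces `ε = 1` and difference `-1` forces `ε' = 1`.
    have h0 := hε.eq_zero_or_one k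
    have h1 := hε.eq_zero_or_one (k + 1)
    have h2 := hε.eq_zero_or_one (k + 2)
    have h3 := hε.eq_zero_or_one (k + 3)
    have h0' := hε'.eq_zero_or_one k
    have h1' := hε'.eq_zero_or_one (k + 1)
    have h2' := hε'.eq_zero_or_one (k + 2)
    have h3' := hε'.eq_zero_or_one (k + 3)
    simp only [List.mem_cons, List.not_mem_nil, or_false] at hs
    rcases hs with rfl | rfl
    · exact hε'.not_four_ones k (by omega)
    · exact hε.not_four_ones k (by omega)

/-- Label and source determine the target of an edge, so the labels fix the whole run. -/
theorem eq_embed_path (h₂ : β₂ ^ 4 = β₂ ^ 3 + β₂ ^ 2 + β₂ + 1)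
    (h₃ : β₃ ^ 4 = β₃ ^ 3 + β₃ ^ 2 + β₃ + 1) {e : ℤ → ℝ × ℂ} (h0 : e l = 0)
    (he : ∀ k : ℕ, e (l + k + 1) = ((e (l + k)).1 / β₂, (e (l + k)).2 / β₃) +
      ((ε (l + k) : ℝ) - (ε' (l + k) : ℝ)) • alphaPow β₂ β₃ 3) (k : ℕ) :
    e (l + k) = embed β₂ β₃ (path (fun k => (ε (l + k) : ℤ) - ε' (l + k)) k) := by
  induction k with
  | zero =>
    simp [h0, path, embed, eval]
    rfl
  | succ k ih =>
    rw [path, embed_step h₂ h₃, ← ih, ← he]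
    push_cast
    rw [add_assoc]

end Main

end QuadVec

open QuadVec in
theorem mainTheorem2
    (β₂ : ℝ) (hβ₂ : Polynomial.aeval β₂ tetraPoly = 0) (hβ₂_abs : |β₂| < 1)
    (β₃ : ℂ) (hβ₃ : Polynomial.aeval β₃ tetraPoly = 0) (hβ₃_im : β₃.im ≠ 0)
    (l : ℤ) (ε ε' : ℤ → ℕ) (hε : MemDInf l ε) (hε' : MemDInf l ε') :
    Summable (fun i : Set.Ici l => (ε i : ℝ) • alphaPow β₂ β₃ i) ∧
    Summable (fun i : Set.Ici l => (ε' i : ℝ) • alphaPow β₂ β₃ i) ∧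
    ((∑' i : Set.Ici l, (ε i : ℝ) • alphaPow β₂ β₃ i =
        ∑' i : Set.Ici l, (ε' i : ℝ) • alphaPow β₂ β₃ i) ↔
      (tetraAutomaton β₂ β₃).IsInfinitePathFromInitial l (fun i => (ε i, ε' i))) := by
  have h₂ := aeval_tetraPoly_eq_zero_iff.1 hβ₂
  have h₃ := aeval_tetraPoly_eq_zero_iff.1 hβ₃
  have z₂ : β₂ ≠ 0 := by rintro rfl; simp at h₂
  have z₃ : β₃ ≠ 0 := by rintro rfl; simp at h₃
  have n₃ : ‖β₃‖ < 1 := (nonrealRoot_norm_bounds h₂ hβ₂_abs h₃ hβ₃_im).trans (by norm_num)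
  refine ⟨(hasSum_digits_alphaPow z₂ z₃ hβ₂_abs n₃ hε).summable,
    (hasSum_digits_alphaPow z₂ z₃ hβ₂_abs n₃ hε').summable, ?_⟩
  rw [tsum_eq_iff z₂ z₃ hβ₂_abs n₃ hε hε']
  constructor
  · rintro ⟨s₂, s₃⟩
    have hmem := fun k => embed_mem_stateSet h₂ h₃
      (path_mem_states h₂ hβ₂_abs h₃ hβ₃_im hε hε' s₂ s₃ k)
    refine ⟨fun n => embed β₂ β₃ (path (fun k => (ε (l + k) : ℤ) - ε' (l + k)) (n - l).toNat),
      fun n _ => hmem _, by simp [tetraAutomaton, path, embed, eval], fun n hn => ?_⟩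
    obtain ⟨k, rfl⟩ := Int.le.dest hn
    refine ⟨_, _, _, _, rfl, hmem _, hmem _, hε.eq_zero_or_one k, hε'.eq_zero_or_one k, ?_⟩
    have e1 : (l + k - l).toNat = k := by simp
    have e2 : (l + k + 1 - l).toNat = k + 1 := by omega
    beta_reduce
    rw [e1, e2, path, embed_step h₂ h₃]
  · rintro ⟨e, hmem, h0, hedge⟩
    have hstep : ∀ k : ℕ, e (l + k + 1) = ((e (l + k)).1 / β₂, (e (l + k)).2 / β₃) +
        ((ε (l + k) : ℝ) - (ε' (l + k) : ℝ)) • alphaPow β₂ β₃ 3 := fun k => by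
      obtain ⟨s, t, a, b, heq, -, -, -, -, ht⟩ := hedge (l + k) (by omega)
      simp only [Prod.mk.injEq] at heq
      obtain ⟨rfl, ⟨rfl, rfl⟩, rfl⟩ := heq
      exact ht
    have hpath := eq_embed_path h₂ h₃ h0 hstep
    obtain ⟨C, hC⟩ := (stateSet_finite β₂ β₃).isBounded.exists_norm_le
    have hb : ∀ k : ℕ, ‖embed β₂ β₃ (path (fun k => (ε (l + k) : ℤ) - ε' (l + k)) k)‖ ≤ C :=
      fun k => by
        rw [← hpath]
        exact hC _ (hmem _ (by omega))
    have hn : ∀ {K : Type} [RCLike K] (k : ℕ),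
        ‖(((ε (l + k) : ℤ) - ε' (l + k) : ℤ) : K)‖ ≤ 1 := fun k => by
      rcases hε.eq_zero_or_one k with h | h <;> rcases hε'.eq_zero_or_one k with h' | h' <;>
        simp [h, h']
    exact ⟨hasSum_zero_of_norm_eval_le h₂ hβ₂_abs rfl (fun _ => rfl)
        (summable_digits hβ₂_abs hn) fun k => (norm_fst_le _).trans (hb k),
      hasSum_zero_of_norm_eval_le h₃ n₃ rfl (fun _ => rfl)
        (summable_digits n₃ hn) fun k => (norm_snd_le _).trans (hb k)⟩
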